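/- Let $E$ be a Euclidean plane with inner product $\langle\cdot,\cdot\rangle$ and let $\Phi\subset E$ be a (reduced, crystallographic) root system spanning $E$. For $\alpha\in\Phi$ and $k\in\mathbb Z$ put $H_{\alpha,k}=\{v\in E:\langle v,\alpha\rangle=k\}$ and let $s_{\alpha;k}$ be the orthogonal reflection in $H_{\alpha,k}$. Let $W$ be the affine Weyl group of $\Phi$, i.e. the group generated by all $s_{\alpha;k}$. The alcoves are the connected components of the complement of $\bigcup_{\alpha,k}H_{\alpha,k}$; fix an alcove $A$ (the identity alcove), identify $x\in W$ with the alcove $xA$, and let $\ell$ be the length function of $W$ with respect to the reflections in the walls of $A$. Two hyperplanes are called adjacent parallel if they are distinct and parallel and no hyperplane $H_{\alpha,k}$ lies strictly between them. **Theorem 1.3.** Let $H_{r_0},H_{r_1},H_{r_2}$ be three distinct parallel hyperplanes among the $H_{\alpha,k}$, with reflections $r_0,r_1,r_2$, such that $H_{r_0},H_{r_1}$ are adjacent and $H_{r_1},H_{r_2}$ are adjacent. Let $x\in W$ be bounded by $H_{r_0}$ and $H_{r_1}$, i.e. the alcove $xA$ lies in the open strip between $H_{r_0}$ and $H_{r_1}$.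 If $$\ell(r_2r_1x)=\ell(r_1x)+1=\ell(x)+2,$$ then $\ell(r_0x)=\ell(x)\pm1$. -/

import Mathlib

noncomputable section

namespace AffineCoxeter

section Euclidean

variable {E : Type*} [NormedAddCommGroup E] [InnerProductSpace ℝ E]

/-- The vector `α^∨ = 2 α / ⟪α, α⟫`. -/
def dualVector (α : E) : E := (2 / inner ℝ α α : ℝ) • α

/-- The affine hyperplane `H_{α,k} = {v | ⟪v, α⟫ = k}`. -/
def hyperplane (α : E) (k : ℤ) : AffineSubspace ℝ E where
  carrier := {v | inner ℝ v α = (k : ℝ)}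
  smul_vsub_vadd_mem' := by
    intro c p₁ p₂ p₃ h₁ h₂ h₃
    simp only [Set.mem_ofPred_eq] at *
    simp [inner_add_left, inner_sub_left, inner_smul_left, h₁, h₂, h₃]

theorem mem_hyperplane {α : E} {k : ℤ} {v : E} :
    v ∈ hyperplane α k ↔ inner ℝ v α = (k : ℝ) := Iff.rfl

/-- The linear reflection `v ↦ v - ⟪v, α⟫ α^∨`, written as a linear isometry. -/
theorem reflection_orthogonal_singleton (α v : E) :
    (ℝ ∙ α)ᗮ.reflection v = v - (inner ℝ v α : ℝ) • dualVector α := by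
  rw [Submodule.reflection_orthogonal_apply, Submodule.reflection_singleton_apply]
  simp only [dualVector, smul_smul, real_inner_comm α v, real_inner_self_eq_norm_sq, RCLike.ofReal_real_eq_id, id]
  rw [neg_sub, ← Nat.cast_smul_eq_nsmul ℝ, smul_smul]
  congr 2
  push_cast
  ring

/-- The reflection `s_{α;k}(v) = v - (⟪v, α⟫ - k) α^∨` in the hyperplane `H_{α,k}`, as an
isometry of the Euclidean space `E`. -/
def affineReflection (α : E) (k : ℤ) : E ≃ᵃⁱ[ℝ] E :=
  AffineIsometryEquiv.mk' (fun v => v - (inner ℝ v α - k : ℝ) • dualVector α)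
    (ℝ ∙ α)ᗮ.reflection 0 (by
      intro v
      simp only [vsub_eq_sub, sub_zero, vadd_eq_add, reflection_orthogonal_singleton,
        inner_zero_left]
      module)

theorem affineReflection_apply (α : E) (k : ℤ) (v : E) :
    affineReflection α k v = v - (inner ℝ v α - k : ℝ) • dualVector α := rfl

end Euclidean

section Length

variable {G : Type*} [Group G]

/-- The word length of `w` with respect to `S`: the least `n` such that `w` is a product of `n`
elements of `S`. It is used only for sets `S` of involutions, so inverses are not needed. -/
def wordLength (S : Set G) (w : G) : ℕ :=
  sInf {n | ∃ l : List G, (∀ s ∈ l, s ∈ S) ∧ l.length = n ∧ l.prod = w}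

end Length

section Complex

variable {ι E N : Type*} [NormedAddCommGroup E] [InnerProductSpace ℝ E]
  [AddCommGroup N] [Module ℝ N] (P : RootPairing ι ℝ E N)

/-- The reflections of `P` in the roots are the orthogonal reflections for the inner product of
`E`; that is, `P` is a root system of the Euclidean space `E` in the classical sense. -/
def IsEuclidean : Prop :=
  ∀ (i : ι) (v : E), P.reflection i v = v - (inner ℝ v (P.root i) : ℝ) • dualVector (P.root i)

/-- The affine Weyl group: the group of isometries generated by all reflections `s_{α;k}` with
`α` a root and `k` an integer. -/
def affineWeylGroup : Subgroup (E ≃ᵃⁱ[ℝ] E) :=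
  Subgroup.closure {s | ∃ (i : ι) (k : ℤ), s = affineReflection (P.root i) k}

/-- The complement of the union of all reflecting hyperplanes `H_{α,k}`. -/
def regularSet : Set E := {v | ∀ (i : ι) (k : ℤ), v ∉ hyperplane (P.root i) k}

/-- An alcove is a connected component of the complement of the reflecting hyperplanes. -/
def IsAlcove (A : Set E) : Prop :=
  ∃ p ∈ regularSet P, A = connectedComponentIn (regularSet P) p

/-- The hyperplane `H` is a wall of the alcove `A`: it is the affine span of a face (panel)
of `A`. -/
def IsWall (A : Set E) (H : AffineSubspace ℝ E) : Prop :=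
  affineSpan ℝ ((H : Set E) ∩ closure A) = H

/-- The Coxeter generators attached to the base alcove `A`: the reflections in the walls
of `A`. -/
def simpleReflections (A : Set E) : Set (E ≃ᵃⁱ[ℝ] E) :=
  {s | ∃ (i : ι) (k : ℤ),
    IsWall A (hyperplane (P.root i) k) ∧ s = affineReflection (P.root i) k}

/-- The Coxeter length on the affine Weyl group, when the alcove `A` is taken as the identity
alcove. -/
def length (A : Set E) (w : E ≃ᵃⁱ[ℝ] E) : ℕ := wordLength (simpleReflections P A) w

/-- `H` lies strictly between `H₁` and `H₂`. -/
def StrictlyBetween (H H₁ H₂ : AffineSubspace ℝ E) : Prop :=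
  ∀ p ∈ H₁, ∀ q ∈ H₂, H.SOppSide p q

/-- `H₁` and `H₂` are adjacent parallel hyperplanes: they are parallel and distinct, and no
reflecting hyperplane lies strictly between them. -/
def AdjacentParallel (H₁ H₂ : AffineSubspace ℝ E) : Prop :=
  H₁.Parallel H₂ ∧ H₁ ≠ H₂ ∧
    ∀ (i : ι) (k : ℤ), ¬ StrictlyBetween (hyperplane (P.root i) k) H₁ H₂

/-- The set `C` lies in the open strip bounded by the parallel hyperplanes `H₁` and `H₂`. -/
def BoundedBy (C : Set E) (H₁ H₂ : AffineSubspace ℝ E) : Prop :=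
  ∀ c ∈ C, (∀ q ∈ H₂, H₁.SSameSide c q) ∧ (∀ p ∈ H₁, H₂.SSameSide c p)

end Complex

end AffineCoxeter

end

noncomputable section

namespace AffineCoxeter

/-! ### Affine reflections. -/

section Reflections

variable {E : Type*} [NormedAddCommGroup E] [InnerProductSpace ℝ E]

/-! Let `α` be the root, suitably oriented, for which the three hyperplanes are the levels `k`, `k +
1`, `k + 2`. An alcove is determined by its coordinates `shi v β = ⌊⟪v, β⟫⌋`. For `a ∈ A`, twice the
length of `x` is the sum over all roots `β` of `|shi (x a) β - shi a β|` (`two_mul_length`): length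
counts separating hyperplanes, and each is seen by a root and by its negative.

The product `r₂ r₁` is translation by `α^∨`. It adds `c = ⟪β, α^∨⟫` to the coordinate `β` and
subtracts `c` from the coordinate `s_α β`, so the sum is grouped into pairs `{β, s_α β}`. Since `r₁`
lengthens `x`, one has `shi a α ≤ shi (x a) α`. Under this inequality the translation decreases no
pair, and a pair it leaves unchanged is also left unchanged by `r₀` (`pairDist_translation`, with
the arithmetic in `natAbs_pair_translation`). The pair `{α, -α}` by itself makes the length grow by
two, which is all the growth allowed. Hence `r₀` affects only this pair; there it moves the
`α`-coordinate from `k` to `k - 1`, a change of length by exactly one.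

The length formula rests on three facts: reflecting in a wall crosses that wall only
(`IsWall.sameHyperplane`), distinct alcoves are separated by a wall of the first
(`IsAlcove.exists_isWall_separates`), and strong exchange holds (`exists_word_of_separates`). -/

theorem inner_self_pos_of_ne_zero {α : E} (hα : α ≠ 0) : 0 < (inner ℝ α α : ℝ) :=
  real_inner_self_pos.2 hα

theorem dualVector_neg (α : E) : dualVector (-α) = -dualVector α := by
  simp [dualVector]

theorem affineReflection_neg (α : E) (k : ℤ) :
    affineReflection (-α) (-k) = affineReflection α k := by
  ext v
  simp only [affineReflection_apply, dualVector_neg, inner_neg_right]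
  push_cast
  module

theorem inner_dualVector_self {α : E} (hα : α ≠ 0) : (inner ℝ (dualVector α) α : ℝ) = 2 := by
  have := (inner_self_pos_of_ne_zero hα).ne'
  rw [dualVector, real_inner_smul_left]
  field_simp

theorem inner_affineReflection_self {α : E} (hα : α ≠ 0) (k : ℤ) (v : E) :
    (inner ℝ (affineReflection α k v) α : ℝ) = 2 * k - inner ℝ v α := by
  rw [affineReflection_apply, inner_sub_left, real_inner_smul_left, inner_dualVector_self hα]
  ring

theorem affineReflection_mul_self {α : E} (hα : α ≠ 0) (k : ℤ) :
    affineReflection α k * affineReflection α k = 1 := by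
  ext v
  change affineReflection α k (affineReflection α k v) = v
  rw [affineReflection_apply α k (affineReflection α k v), inner_affineReflection_self hα,
    affineReflection_apply]
  module

theorem affineReflection_apply_self {α : E} (hα : α ≠ 0) (k : ℤ) (v : E) :
    affineReflection α k (affineReflection α k v) = v :=
  congrArg (fun g : E ≃ᵃⁱ[ℝ] E => g v) (affineReflection_mul_self hα k)

theorem affineReflection_mul_mul_cancel {α : E} (hα : α ≠ 0) (k : ℤ) (g : E ≃ᵃⁱ[ℝ] E) :
    affineReflection α k * (affineReflection α k * g) = g := by
  rw [← mul_assoc, affineReflection_mul_self hα, one_mul]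

theorem affineReflection_apply_eq_self {α : E} {k : ℤ} {v : E} (hv : (inner ℝ v α : ℝ) = k) :
    affineReflection α k v = v := by
  rw [affineReflection_apply, hv, sub_self, zero_smul, sub_zero]

end Reflections

/-! ### Floor coordinates, separation, and the action of reflections on them. -/

section RootSystem

variable {ι E N : Type*} [NormedAddCommGroup E] [InnerProductSpace ℝ E]
  [AddCommGroup N] [Module ℝ N] (P : RootPairing ι ℝ E N)

/-- The pairs `(i, k)` and `(j, m)` define the same affine hyperplane. -/
def SameHyperplane (i : ι) (k : ℤ) (j : ι) (m : ℤ) : Prop :=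
  (P.root j = P.root i ∧ m = k) ∨ (P.root j = -P.root i ∧ m = -k)

/-- The hyperplane `H_{i,k}` separates the points `p` and `q`. -/
def Separates (i : ι) (k : ℤ) (p q : E) : Prop :=
  (inner ℝ p (P.root i) - k : ℝ) * (inner ℝ q (P.root i) - k) < 0

/-- The integer coordinates of a point, which determine the alcove containing it. -/
def shi (v : E) (i : ι) : ℤ := ⌊(inner ℝ v (P.root i) : ℝ)⌋

/-- The index of the image of the hyperplane `H_{i,k}` under the reflection in `H_{j,m}`. -/
def reflectLevel [P.IsCrystallographic] (j : ι) (m : ℤ) (i : ι) (k : ℤ) : ℤ :=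
  k - m * P.pairingIn ℤ i j

variable {P}

theorem SameHyperplane.affineReflection_eq {i j : ι} {k m : ℤ} (h : SameHyperplane P i k j m) :
    affineReflection (P.root j) m = affineReflection (P.root i) k := by
  rcases h with ⟨h, rfl⟩ | ⟨h, rfl⟩
  · rw [h]
  · rw [h, affineReflection_neg]

theorem separates_comm {i : ι} {k : ℤ} {p q : E} :
    Separates P i k p q ↔ Separates P i k q p := by
  rw [Separates, Separates, mul_comm]

theorem SameHyperplane.separates_iff {i j : ι} {k m : ℤ} (h : SameHyperplane P i k j m)
    {p q : E} : Separates P j m p q ↔ Separates P i k p q := by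
  rcases h with ⟨h, rfl⟩ | ⟨h, rfl⟩
  · rw [Separates, Separates, h]
  · rw [Separates, Separates, h, inner_neg_right, inner_neg_right]
    push_cast
    ring_nf

theorem separates_trans_left {i : ι} {k : ℤ} {p q r : E} (hq : q ∈ regularSet P)
    (h : Separates P i k p r) (h' : ¬ Separates P i k p q) : Separates P i k q r := by
  have hq' := sub_ne_zero.2 (hq i k)
  unfold Separates at *
  by_contra h2
  have h3 := mul_nonneg (not_lt.1 h') (not_lt.1 h2)
  have h4 := mul_neg_of_pos_of_neg (pow_pos (abs_pos.2 hq') 2) h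
  rw [sq_abs] at h4
  linarith

theorem shi_lt_inner {v : E} (hv : v ∈ regularSet P) (i : ι) :
    (shi P v i : ℝ) < inner ℝ v (P.root i) :=
  lt_of_le_of_ne (Int.floor_le _) (Ne.symm (hv i _))

theorem inner_lt_shi {v : E} (i : ι) : (inner ℝ v (P.root i) : ℝ) < shi P v i + 1 :=
  Int.lt_floor_add_one _

theorem lt_inner_iff {v : E} (hv : v ∈ regularSet P) {i : ι} {k : ℤ} :
    (k : ℝ) < inner ℝ v (P.root i) ↔ k ≤ shi P v i := by
  rw [shi, Int.le_floor]
  exact ⟨le_of_lt, fun h => lt_of_le_of_ne h (Ne.symm (hv i k))⟩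

theorem inner_lt_iff {v : E} {i : ι} {k : ℤ} :
    (inner ℝ v (P.root i) : ℝ) < k ↔ shi P v i < k := by
  rw [shi, Int.floor_lt]

theorem separates_iff_shi {p q : E} (hp : p ∈ regularSet P) (hq : q ∈ regularSet P) {i : ι}
    {k : ℤ} : Separates P i k p q ↔
      (k ≤ shi P p i ∧ shi P q i < k) ∨ (shi P p i < k ∧ k ≤ shi P q i) := by
  rw [Separates, mul_neg_iff, sub_pos, sub_pos, sub_neg, sub_neg, lt_inner_iff hp,
    lt_inner_iff hq, inner_lt_iff, inner_lt_iff]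

theorem shi_of_root_eq_neg {v : E} (hv : v ∈ regularSet P) {i j : ι}
    (h : P.root j = -P.root i) : shi P v j = -shi P v i - 1 := by
  have h1 := shi_lt_inner hv i
  have h2 := inner_lt_shi (P := P) (v := v) i
  rw [shi, Int.floor_eq_iff, h, inner_neg_right]
  push_cast
  constructor <;> linarith

/-- The component `u` of `β` orthogonal to `α` is a direction of the first hyperplane, so `β` is
constant along it; thus `⟪u, β⟫ = ⟪u, u⟫ = 0` and `β` is a multiple of `α`. The levels are real
because a translated hyperplane need not have an integral level a priori. -/
theorem root_eq_or_eq_neg_of_subset [P.IsReduced] {i j : ι} {k m : ℝ}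
    (h : ∀ v : E, (inner ℝ v (P.root i) : ℝ) = k → (inner ℝ v (P.root j) : ℝ) = m) :
    (P.root j = P.root i ∧ m = k) ∨ (P.root j = -P.root i ∧ m = -k) := by
  set α := P.root i with hα
  set β := P.root j with hβ
  have hpos : (inner ℝ α α : ℝ) ≠ 0 := (inner_self_pos_of_ne_zero (P.ne_zero i)).ne'
  set v₀ : E := (k / inner ℝ α α : ℝ) • α with hv₀
  have h0 : (inner ℝ v₀ α : ℝ) = k := by
    rw [hv₀, real_inner_smul_left]
    field_simp
  set u : E := β - (inner ℝ β α / inner ℝ α α : ℝ) • α with hu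
  have hu0 : (inner ℝ u α : ℝ) = 0 := by
    rw [hu, inner_sub_left, real_inner_smul_left]
    field_simp
    ring
  have h1 := h v₀ h0
  have h2 := h (v₀ + u) (by rw [inner_add_left, h0, hu0, add_zero])
  have h3 : (inner ℝ u β : ℝ) = 0 := by rw [inner_add_left] at h2; linarith
  have h4 : (inner ℝ u u : ℝ) = 0 := by
    conv_lhs => rw [hu]
    rw [inner_sub_left, real_inner_smul_left, real_inner_comm u β, h3, real_inner_comm u α, hu0]
    simp
  have h5 : β = (inner ℝ β α / inner ℝ α α : ℝ) • α := by
    rw [inner_self_eq_zero] at h4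
    exact sub_eq_zero.1 h4
  have hdep : ¬ LinearIndependent ℝ ![P.root j, P.root i] := by
    intro hli
    rw [LinearIndependent.pair_iff] at hli
    have := hli 1 (-(inner ℝ β α / inner ℝ α α : ℝ)) (by
      rw [one_smul, neg_smul, ← sub_eq_add_neg, sub_eq_zero]; exact h5)
    exact one_ne_zero this.1
  rcases RootPairing.IsReduced.eq_or_eq_neg (P := P) j i hdep with h6 | h6
  · refine Or.inl ⟨h6, ?_⟩
    rw [hβ, h6, h0] at h1
    exact h1.symm
  · refine Or.inr ⟨h6, ?_⟩
    rw [hβ, h6, inner_neg_right, h0] at h1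
    exact h1.symm

theorem sameHyperplane_of_subset [P.IsReduced] {i j : ι} {k m : ℤ}
    (h : ∀ v : E, (inner ℝ v (P.root i) : ℝ) = k → (inner ℝ v (P.root j) : ℝ) = m) :
    SameHyperplane P i k j m := by
  rcases root_eq_or_eq_neg_of_subset h with ⟨h1, h2⟩ | ⟨h1, h2⟩
  · exact Or.inl ⟨h1, by exact_mod_cast h2⟩
  · exact Or.inr ⟨h1, by exact_mod_cast h2⟩

variable (hP : IsEuclidean P)
include hP

theorem root_reflectionPerm_eq (j i : ι) :
    P.root (P.reflectionPerm j i) =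
      P.root i - (inner ℝ (P.root i) (P.root j) : ℝ) • dualVector (P.root j) := by
  rw [P.root_reflectionPerm, hP]

theorem pairing_eq_inner (i j : ι) :
    P.pairing i j = (inner ℝ (dualVector (P.root j)) (P.root i) : ℝ) := by
  have h := P.reflection_apply_root j i
  rw [hP j (P.root i), sub_right_inj] at h
  have h2 := congrArg (fun v => (inner ℝ v (P.root j) : ℝ)) h
  have hpos := inner_self_pos_of_ne_zero (P.ne_zero j)
  simp only [real_inner_smul_left, inner_dualVector_self (P.ne_zero j)] at h2
  rw [dualVector, real_inner_smul_left, real_inner_comm (P.root i)]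
  field_simp
  linarith

variable [P.IsCrystallographic]

theorem pairingIn_eq_inner (i j : ι) :
    (P.pairingIn ℤ i j : ℝ) = inner ℝ (dualVector (P.root j)) (P.root i) := by
  rw [← pairing_eq_inner hP]
  exact P.algebraMap_pairingIn ℤ i j

omit hP in
theorem root_reflectionPerm_eq_pairingIn (j i : ι) :
    P.root (P.reflectionPerm j i) = P.root i - (P.pairingIn ℤ i j : ℝ) • P.root j := by
  rw [P.root_reflectionPerm, P.reflection_apply_root, ← P.algebraMap_pairingIn ℤ i j]
  rfl

theorem inner_affineReflection_root (j : ι) (m : ℤ) (v : E) (i : ι) :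
    (inner ℝ (affineReflection (P.root j) m v) (P.root i) : ℝ) =
      inner ℝ v (P.root (P.reflectionPerm j i)) + (m * P.pairingIn ℤ i j : ℤ) := by
  rw [affineReflection_apply, root_reflectionPerm_eq_pairingIn, inner_sub_left,
    real_inner_smul_left, ← pairingIn_eq_inner hP, inner_sub_right, real_inner_smul_right]
  push_cast
  ring

theorem inner_affineReflection_sub_level (j : ι) (m : ℤ) (v : E) (i : ι) (k : ℤ) :
    (inner ℝ (affineReflection (P.root j) m v) (P.root i) - k : ℝ) =
      inner ℝ v (P.root (P.reflectionPerm j i)) - (reflectLevel P j m i k : ℤ) := by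
  rw [inner_affineReflection_root hP, reflectLevel]
  push_cast
  ring

theorem separates_affineReflection (j : ι) (m : ℤ) (i : ι) (k : ℤ) (p q : E) :
    Separates P i k (affineReflection (P.root j) m p) (affineReflection (P.root j) m q) ↔
      Separates P (P.reflectionPerm j i) (reflectLevel P j m i k) p q := by
  rw [Separates, Separates, inner_affineReflection_sub_level hP,
    inner_affineReflection_sub_level hP]

omit [P.IsCrystallographic] in
theorem dualVector_reflectionPerm (j i : ι) :
    dualVector (P.root (P.reflectionPerm j i)) =
      (ℝ ∙ P.root j)ᗮ.reflection (dualVector (P.root i)) := by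
  have h : P.root (P.reflectionPerm j i) = (ℝ ∙ P.root j)ᗮ.reflection (P.root i) := by
    rw [reflection_orthogonal_singleton, root_reflectionPerm_eq hP]
  rw [dualVector, h, LinearIsometryEquiv.inner_map_map, dualVector, map_smul]

theorem affineReflection_conj (j : ι) (m : ℤ) (i : ι) (k : ℤ) :
    affineReflection (P.root j) m * (affineReflection (P.root i) k * affineReflection (P.root j) m)
      = affineReflection (P.root (P.reflectionPerm j i)) (reflectLevel P j m i k) := by
  ext v
  change affineReflection (P.root j) m (affineReflection (P.root i) k
    (affineReflection (P.root j) m v)) = _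
  rw [affineReflection_apply (P.root i), inner_affineReflection_sub_level hP,
    affineReflection_apply (P.root (P.reflectionPerm j i)), dualVector_reflectionPerm hP]
  set c : ℝ := inner ℝ v (P.root (P.reflectionPerm j i)) - (reflectLevel P j m i k : ℤ)
  have h := affineReflection_apply_self (P.ne_zero j) m v
  conv_rhs => rw [← h]
  rw [affineReflection_apply (P.root j) m (_ - _),
    affineReflection_apply (P.root j) m (affineReflection (P.root j) m v), inner_sub_left,
    reflection_orthogonal_singleton, real_inner_smul_left]
  module

theorem affineReflection_mem_regularSet {j : ι} {m : ℤ} {v : E} (hv : v ∈ regularSet P) :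
    affineReflection (P.root j) m v ∈ regularSet P := by
  intro i k h
  rw [mem_hyperplane, ← sub_eq_zero, inner_affineReflection_sub_level hP, sub_eq_zero] at h
  exact hv _ _ h

theorem shi_affineReflection (j : ι) (m : ℤ) (v : E) (i : ι) :
    shi P (affineReflection (P.root j) m v) i =
      shi P v (P.reflectionPerm j i) + m * P.pairingIn ℤ i j := by
  rw [shi, inner_affineReflection_root hP, Int.floor_add_intCast, shi]

omit hP [P.IsCrystallographic] in
variable (P) in
/-- Twice the number of hyperplanes separating `p` and `q`. -/
def shiDist [Fintype ι] (p q : E) : ℕ := ∑ i, (shi P p i - shi P q i).natAbs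

omit hP [P.IsCrystallographic] in
theorem shiDist_comm [Fintype ι] (p q : E) : shiDist P p q = shiDist P q p :=
  Finset.sum_congr rfl fun i _ => by rw [← Int.natAbs_neg, neg_sub]

omit hP [P.IsCrystallographic] in
theorem shiDist_eq_zero_iff [Fintype ι] {p q : E} : shiDist P p q = 0 ↔ shi P p = shi P q := by
  rw [shiDist, Finset.sum_eq_zero_iff, funext_iff]
  simp [sub_eq_zero]

/-- A reflection permutes the coordinates and shifts them by amounts independent of the point, so
the differences are merely permuted. -/
theorem shiDist_affineReflection [Fintype ι] (j : ι) (m : ℤ) (p q : E) :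
    shiDist P (affineReflection (P.root j) m p) (affineReflection (P.root j) m q) =
      shiDist P p q := by
  rw [shiDist, shiDist, ← Equiv.sum_comp (P.reflectionPerm j)]
  refine Finset.sum_congr rfl fun i _ => ?_
  rw [shi_affineReflection hP, shi_affineReflection hP, P.reflectionPerm_self,
    add_sub_add_right_eq_sub]

end RootSystem

/-! ### Alcoves as fibres of the floor coordinates. -/

section Alcoves

variable {ι E N : Type*} [NormedAddCommGroup E] [InnerProductSpace ℝ E]
  [AddCommGroup N] [Module ℝ N] {P : RootPairing ι ℝ E N}

theorem regular_and_shi_eq_iff {v : E} {f : ι → ℤ} :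
    (v ∈ regularSet P ∧ shi P v = f) ↔
      ∀ i, (f i : ℝ) < inner ℝ v (P.root i) ∧ (inner ℝ v (P.root i) : ℝ) < f i + 1 := by
  constructor
  · rintro ⟨hv, rfl⟩ i
    exact ⟨shi_lt_inner hv i, inner_lt_shi i⟩
  · intro h
    refine ⟨fun i k hk => ?_, funext fun i => Int.floor_eq_iff.2 ⟨(h i).1.le, (h i).2⟩⟩
    rw [mem_hyperplane] at hk
    have h1 := (h i).1
    have h2 := (h i).2
    rw [hk] at h1 h2
    norm_cast at h1 h2
    omega

theorem convex_shi_fiber (f : ι → ℤ) : Convex ℝ {v : E | v ∈ regularSet P ∧ shi P v = f} := by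
  simp only [regular_and_shi_eq_iff]
  intro v hv w hw s t hs ht hst i
  simp only [inner_add_left, real_inner_smul_left]
  obtain ⟨h1, h2⟩ := hv i
  obtain ⟨h3, h4⟩ := hw i
  obtain rfl : t = 1 - s := by linarith
  rcases hs.eq_or_lt with rfl | hs
  · constructor <;> linarith
  · constructor <;> nlinarith

theorem isOpen_shi_fiber [Finite ι] (f : ι → ℤ) :
    IsOpen {v : E | v ∈ regularSet P ∧ shi P v = f} := by
  simp only [regular_and_shi_eq_iff, Set.ofPred_forall, Set.ofPred_and]
  exact isOpen_iInter_of_finite fun i =>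
    (isOpen_lt (by fun_prop) (by fun_prop)).inter (isOpen_lt (by fun_prop) (by fun_prop))

theorem IsAlcove.subset_regularSet {A : Set E} (hA : IsAlcove P A) : A ⊆ regularSet P := by
  obtain ⟨p, -, rfl⟩ := hA
  exact connectedComponentIn_subset _ _

theorem IsAlcove.nonempty {A : Set E} (hA : IsAlcove P A) : A.Nonempty := by
  obtain ⟨p, hp, rfl⟩ := hA
  exact ⟨p, mem_connectedComponentIn hp⟩

theorem IsPreconnected.shi_le {A : Set E} (hA : IsPreconnected A) (hreg : A ⊆ regularSet P)
    {v w : E} (hv : v ∈ A) (hw : w ∈ A) (i : ι) : shi P v i ≤ shi P w i := by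
  by_contra! hlt
  obtain ⟨x, hx, hxe⟩ := hA.intermediate_value₂ (f := fun x => (inner ℝ x (P.root i) : ℝ))
    (g := fun _ => (shi P v i : ℝ)) hw hv (by fun_prop) (by fun_prop) (inner_lt_iff.2 hlt).le
    (shi_lt_inner (hreg hv) i).le
  exact hreg hx i _ hxe

/-- By the intermediate value theorem the coordinates are constant on a connected regular set;
conversely a fibre is convex, hence connected. -/
theorem IsAlcove.eq_shi_fiber {A : Set E} (hA : IsAlcove P A) {a : E} (ha : a ∈ A) :
    A = {v | v ∈ regularSet P ∧ shi P v = shi P a} := by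
  have hreg := hA.subset_regularSet
  obtain ⟨p, -, rfl⟩ := hA
  have hpre : IsPreconnected (connectedComponentIn (regularSet P) p) :=
    isPreconnected_connectedComponentIn
  refine Set.Subset.antisymm (fun v hv => ⟨hreg hv, funext fun i => le_antisymm
    (IsPreconnected.shi_le hpre hreg hv ha i) (IsPreconnected.shi_le hpre hreg ha hv i)⟩) ?_
  rw [connectedComponentIn_eq ha]
  exact (convex_shi_fiber _).isPreconnected.subset_connectedComponentIn ⟨hreg ha, rfl⟩
    fun v hv => hv.1

/-- The closed cell around an alcove is contained in the closure of the alcove. -/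
theorem mem_closure_shi_fiber {a q : E} (ha : a ∈ regularSet P)
    (hq : ∀ i, (shi P a i : ℝ) ≤ inner ℝ q (P.root i) ∧
      (inner ℝ q (P.root i) : ℝ) ≤ shi P a i + 1) :
    q ∈ closure {v | v ∈ regularSet P ∧ shi P v = shi P a} := by
  have hlim : Filter.Tendsto (fun t : ℝ => AffineMap.lineMap q a t)
      (nhdsWithin 0 (Set.Ioi 0)) (nhds q) := by
    have hc : Continuous fun t : ℝ => (AffineMap.lineMap q a t : E) := by fun_prop
    simpa using (hc.tendsto 0).mono_left nhdsWithin_le_nhds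
  refine mem_closure_of_tendsto hlim ?_
  filter_upwards [Ioo_mem_nhdsGT (zero_lt_one (α := ℝ))] with t ht
  refine regular_and_shi_eq_iff.2 fun i => ?_
  have h1 := shi_lt_inner ha i
  have h2 := inner_lt_shi (P := P) (v := a) i
  obtain ⟨h3, h4⟩ := hq i
  obtain ⟨ht0, ht1⟩ := ht
  simp only [AffineMap.lineMap_apply, vsub_eq_sub, vadd_eq_add, inner_add_left,
    real_inner_smul_left, inner_sub_left]
  constructor <;> nlinarith

theorem exists_separates_of_shi_ne {a b : E} (ha : a ∈ regularSet P) (hb : b ∈ regularSet P)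
    {i : ι} (h : shi P a i ≠ shi P b i) : ∃ k, Separates P i k a b := by
  simp only [separates_iff_shi ha hb]
  rcases lt_or_gt_of_ne h with h | h
  · exact ⟨shi P b i, Or.inr ⟨h, le_rfl⟩⟩
  · exact ⟨shi P a i, Or.inl ⟨le_rfl, h⟩⟩

theorem not_separates_of_shi_eq {a b : E} (ha : a ∈ regularSet P) (hb : b ∈ regularSet P)
    (h : shi P a = shi P b) (i : ι) (k : ℤ) : ¬ Separates P i k a b := by
  rw [separates_iff_shi ha hb, h]
  omega

theorem root_ne_neg (i : ι) : P.root i ≠ -P.root i := by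
  intro h
  have h2 : (2 : ℝ) • P.root i = 0 := by
    rw [two_smul]
    exact eq_neg_iff_add_eq_zero.1 h
  exact P.ne_zero i ((smul_eq_zero.1 h2).resolve_left two_ne_zero)

/-! ### Crossing a wall. -/

section Walls

variable [P.IsCrystallographic] [P.IsReduced] (hP : IsEuclidean P) {A : Set E}
  (hA : IsAlcove P A) {a : E} (ha : a ∈ A) {i : ι} {k : ℤ}
  (hw : IsWall A (hyperplane (P.root i) k))

include hP hA ha hw

/-- An alcove and its image under the reflection in a wall are separated by this wall only. -/
theorem IsWall.sameHyperplane {j : ι} {m : ℤ}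
    (hs : Separates P j m a (affineReflection (P.root i) k a)) : SameHyperplane P i k j m := by
  have har := hA.subset_regularSet ha
  have hsar := affineReflection_mem_regularSet hP (j := i) (m := k) har
  -- The closures of `A` and of its mirror image lie on opposite closed sides of `H_{j,m}`. A point
  -- of the wall in `closure A` is fixed by the reflection, so it lies on both sides, hence on
  -- `H_{j,m}`; such points span the wall.
  have hcl : closure A ⊆ {v | 0 ≤ (inner ℝ a (P.root j) - m : ℝ) * (inner ℝ v (P.root j) - m) ∧
      (inner ℝ a (P.root j) - m : ℝ) *
        (inner ℝ (affineReflection (P.root i) k v) (P.root j) - m) ≤ 0} := by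
    have hc := (affineReflection (P.root i) k).continuous
    refine closure_minimal (fun v hv => ?_) ?_
    swap
    · rw [Set.ofPred_and]
      exact (isClosed_le (by fun_prop) (by fun_prop)).inter
        (isClosed_le (by fun_prop) (by fun_prop))
    have hvr := hA.subset_regularSet hv
    have hav : shi P a = shi P v := by
      rw [hA.eq_shi_fiber ha] at hv
      exact hv.2.symm
    refine ⟨not_lt.1 (not_separates_of_shi_eq har hvr hav j m), le_of_lt ?_⟩
    refine separates_comm.1 (separates_trans_left
      (affineReflection_mem_regularSet hP (j := i) (m := k) hvr) (separates_comm.1 hs) ?_)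
    rw [separates_affineReflection hP]
    exact not_separates_of_shi_eq har hvr hav _ _
  have hle : hyperplane (P.root i) k ≤ hyperplane (P.root j) m := by
    rw [← hw, affineSpan_le]
    rintro q ⟨hqH, hqA⟩
    obtain ⟨h1, h2⟩ := hcl hqA
    rw [affineReflection_apply_eq_self hqH] at h2
    have h3 := le_antisymm h2 h1
    exact sub_eq_zero.1 ((mul_eq_zero.1 h3).resolve_left (sub_ne_zero.2 (har j m)))
  exact sameHyperplane_of_subset fun v hv => hle hv

theorem IsWall.shi_affineReflection_of_ne {j : ι} (h1 : P.root j ≠ P.root i)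
    (h2 : P.root j ≠ -P.root i) : shi P (affineReflection (P.root i) k a) j = shi P a j := by
  have har := hA.subset_regularSet ha
  by_contra hne
  obtain ⟨m, hm⟩ := exists_separates_of_shi_ne har
    (affineReflection_mem_regularSet hP (j := i) (m := k) har) (Ne.symm hne)
  rcases IsWall.sameHyperplane hP hA ha hw hm with h | h
  · exact h1 h.1
  · exact h2 h.1

theorem IsWall.shi_affineReflection_self :
    (shi P a i = k ∧ shi P (affineReflection (P.root i) k a) i = k - 1) ∨
      (shi P a i = k - 1 ∧ shi P (affineReflection (P.root i) k a) i = k) := by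
  have har := hA.subset_regularSet ha
  have hsr := affineReflection_mem_regularSet hP (j := i) (m := k) har
  have key : ∀ m, m ≠ k → ¬ Separates P i m a (affineReflection (P.root i) k a) := by
    intro m hm hs
    rcases IsWall.sameHyperplane hP hA ha hw hs with h | h
    · exact hm h.2
    · exact root_ne_neg i h.1
  have hsep : Separates P i k a (affineReflection (P.root i) k a) := by
    rw [Separates, inner_affineReflection_self (P.ne_zero i)]
    have := pow_pos (abs_pos.2 (sub_ne_zero.2 (har i k))) 2
    rw [sq_abs] at this
    nlinarith
  simp only [separates_iff_shi har hsr] at key hsep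
  have k1 := key (k + 1) (by omega)
  have k2 := key (k - 1) (by omega)
  omega

theorem IsWall.separates_affineReflection_self :
    Separates P i k a (affineReflection (P.root i) k a) := by
  have har := hA.subset_regularSet ha
  rw [separates_iff_shi har (affineReflection_mem_regularSet hP (j := i) (m := k) har)]
  have := IsWall.shi_affineReflection_self hP hA ha hw
  omega

theorem IsWall.shiDist_sub [Fintype ι] (b : E) :
    (shiDist P a b : ℤ) - shiDist P (affineReflection (P.root i) k a) b =
      (|shi P a i - shi P b i| - |shi P (affineReflection (P.root i) k a) i - shi P b i|) +
      (|shi P a (P.reflectionPerm i i) - shi P b (P.reflectionPerm i i)| -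
        |shi P (affineReflection (P.root i) k a) (P.reflectionPerm i i) -
          shi P b (P.reflectionPerm i i)|) := by
  have hneg : P.root (P.reflectionPerm i i) = -P.root i := by simp
  rw [shiDist, shiDist]
  push_cast
  rw [← Finset.sum_sub_distrib]
  refine Fintype.sum_eq_add i (P.reflectionPerm i i) (fun h => ?_) fun j hj => ?_
  · rw [← h] at hneg
    exact root_ne_neg i hneg
  · rw [IsWall.shi_affineReflection_of_ne hP hA ha hw (fun h => hj.1 (P.root.injective h))
      (fun h => hj.2 (P.root.injective (h.trans hneg.symm)))]
    simp

/-- Only the coordinates of the root of the wall and of its negative change, each by one; hence the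
`2`. -/
theorem IsWall.shiDist_of_separates [Fintype ι] {b : E} (hb : b ∈ regularSet P)
    (hs : Separates P i k a b) :
    shiDist P (affineReflection (P.root i) k a) b + 2 = shiDist P a b := by
  have har := hA.subset_regularSet ha
  have hsr := affineReflection_mem_regularSet hP (j := i) (m := k) har
  have hneg : P.root (P.reflectionPerm i i) = -P.root i := by simp
  have h := IsWall.shiDist_sub hP hA ha hw b
  rw [shi_of_root_eq_neg har hneg, shi_of_root_eq_neg hsr hneg, shi_of_root_eq_neg hb hneg] at h
  have h2 := IsWall.shi_affineReflection_self hP hA ha hw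
  rw [separates_iff_shi har hb] at hs
  simp only [Int.abs_eq_natAbs] at h
  omega

theorem IsWall.shiDist_of_not_separates [Fintype ι] {b : E} (hb : b ∈ regularSet P)
    (hs : ¬ Separates P i k a b) :
    shiDist P (affineReflection (P.root i) k a) b = shiDist P a b + 2 := by
  have har := hA.subset_regularSet ha
  have hsr := affineReflection_mem_regularSet hP (j := i) (m := k) har
  have hneg : P.root (P.reflectionPerm i i) = -P.root i := by simp
  have h := IsWall.shiDist_sub hP hA ha hw b
  rw [shi_of_root_eq_neg har hneg, shi_of_root_eq_neg hsr hneg, shi_of_root_eq_neg hb hneg] at h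
  have h2 := IsWall.shi_affineReflection_self hP hA ha hw
  rw [separates_iff_shi har hb] at hs
  simp only [Int.abs_eq_natAbs] at h
  omega

end Walls

end Alcoves

/-! ### Existence of a separating wall. -/

section ExistsWall

variable {ι E N : Type*} [NormedAddCommGroup E] [InnerProductSpace ℝ E]
  [AddCommGroup N] [Module ℝ N] {P : RootPairing ι ℝ E N}

theorem dense_inner_ne {β : E} (hβ : β ≠ 0) (c : ℝ) : Dense {v : E | (inner ℝ v β : ℝ) ≠ c} := by
  have hne : innerSL ℝ β ≠ 0 := by
    intro h
    have h2 := congrArg (fun f : StrongDual ℝ E => f β) h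
    simp only [innerSL_apply_apply, zero_apply] at h2
    exact hβ (inner_self_eq_zero.1 h2)
  have h := (dense_compl_singleton c).preimage
    (ContinuousLinearMap.isOpenMap_of_ne_zero (innerSL ℝ β) hne)
  convert h using 1
  ext v
  simp [real_inner_comm v β]

theorem SameHyperplane.inner_eq {i j : ι} {k m : ℤ} (h : SameHyperplane P i k j m) {q : E}
    (hq : (inner ℝ q (P.root i) : ℝ) = k) : (inner ℝ q (P.root j) : ℝ) = m := by
  rcases h with ⟨h, rfl⟩ | ⟨h, rfl⟩
  · rw [h, hq]
  · rw [h, inner_neg_right, hq]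
    push_cast
    rfl

/-- A point of a given open set from which the segment to `b` crosses distinct hyperplanes at
distinct points. -/
theorem exists_generic_point [Finite ι] [CompleteSpace E] [P.IsReduced] {b : E}
    (hb : b ∈ regularSet P) {U : Set E} (hU : IsOpen U) (hUne : U.Nonempty) :
    ∃ a ∈ U, ∀ (i : ι) (k : ℤ) (j : ι) (m : ℤ),
      (inner ℝ a (P.root i) - k : ℝ) * (inner ℝ b (P.root j) - m) =
        (inner ℝ a (P.root j) - m : ℝ) * (inner ℝ b (P.root i) - k) →
      SameHyperplane P i k j m := by
  -- For fixed `b`, the condition that the two crossings coincide is linear in `a`: it reads `⟪a, β⟫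
  -- = c`. Since `b` is regular, `β` vanishes only for equal hyperplanes. The remaining conditions
  -- are countably many, so Baire's theorem gives a point of `U` avoiding all of them.
  let β : (ι × ℤ) × ι × ℤ → E := fun x =>
    (x.2.2 - inner ℝ b (P.root x.2.1) : ℝ) • P.root x.1.1 +
      (inner ℝ b (P.root x.1.1) - x.1.2 : ℝ) • P.root x.2.1
  let c : (ι × ℤ) × ι × ℤ → ℝ := fun x =>
    x.2.2 * inner ℝ b (P.root x.1.1) - x.1.2 * inner ℝ b (P.root x.2.1)
  let T := {x : (ι × ℤ) × ι × ℤ // ¬ SameHyperplane P x.1.1 x.1.2 x.2.1 x.2.2}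
  have hβ : ∀ x : T, β x.1 ≠ 0 := by
    rintro ⟨⟨⟨i, k⟩, j, m⟩, hx⟩ h0
    simp only [β] at h0 hx
    have hi := sub_ne_zero.2 (hb i k)
    have hdep : ¬ LinearIndependent ℝ ![P.root j, P.root i] := by
      intro hli
      rw [LinearIndependent.pair_iff] at hli
      exact hi (hli _ _ ((add_comm _ _).trans h0)).1
    refine hx ?_
    rcases RootPairing.IsReduced.eq_or_eq_neg (P := P) j i hdep with h | h
    · refine Or.inl ⟨h, ?_⟩
      rw [h, ← add_smul] at h0
      have h1 := (smul_eq_zero.1 h0).resolve_right (P.ne_zero i)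
      have h2 : (m : ℝ) = k := by linarith
      exact_mod_cast h2
    · refine Or.inr ⟨h, ?_⟩
      rw [h, inner_neg_right, smul_neg, ← neg_smul, ← add_smul] at h0
      have h1 := (smul_eq_zero.1 h0).resolve_right (P.ne_zero i)
      have h2 : (m : ℝ) = -k := by linarith
      exact_mod_cast h2
  have hd : Dense (⋂ x : T, {v : E | (inner ℝ v (β x.1) : ℝ) ≠ c x.1}) :=
    dense_iInter_of_isOpen
      (fun x => isOpen_ne_fun (by fun_prop) (by fun_prop)) fun x => dense_inner_ne (hβ x) _
  obtain ⟨a, haU, ha⟩ := hd.inter_open_nonempty U hU hUne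
  refine ⟨a, haU, fun i k j m h => ?_⟩
  by_contra hx
  refine Set.mem_iInter.1 ha ⟨⟨⟨i, k⟩, j, m⟩, hx⟩ ?_
  simp only [β, c, inner_add_right, real_inner_smul_right]
  linarith

theorem finite_separates [Finite ι] {a b : E} (ha : a ∈ regularSet P) (hb : b ∈ regularSet P) :
    {x : ι × ℤ | Separates P x.1 x.2 a b}.Finite := by
  refine (Set.finite_iUnion fun i : ι => (Set.finite_Icc (min (shi P a i) (shi P b i))
    (max (shi P a i) (shi P b i))).image (Prod.mk i)).subset ?_
  rintro ⟨i, k⟩ h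
  rw [Set.mem_ofPred_eq, separates_iff_shi ha hb] at h
  refine Set.mem_iUnion.2 ⟨i, k, Set.mem_Icc.2 ?_, rfl⟩
  dsimp only at h
  omega

/-- Starting at `p`, a short step in any direction of the hyperplane stays in the closed cell,
because the other inequalities are strict at `p` and finite in number. Rescaling such steps reaches
every point of the hyperplane. -/
theorem isWall_of_mem {a : E} (ha : a ∈ regularSet P) [Finite ι] {i : ι} {k : ℤ} {p : E}
    (hp : (inner ℝ p (P.root i) : ℝ) = k)
    (hside : ∀ (j : ι) (m : ℤ), ¬ SameHyperplane P i k j m →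
      0 < (inner ℝ a (P.root j) - m : ℝ) * (inner ℝ p (P.root j) - m)) :
    IsWall {v | v ∈ regularSet P ∧ shi P v = shi P a} (hyperplane (P.root i) k) := by
  have key : ∀ u : E, (inner ℝ u (P.root i) : ℝ) = 0 → ∀ᶠ ε : ℝ in nhdsWithin 0 (Set.Ioi 0),
      p + ε • u ∈ closure {v | v ∈ regularSet P ∧ shi P v = shi P a} := by
    intro u hu
    have hH : ∀ ε : ℝ, (inner ℝ (p + ε • u) (P.root i) : ℝ) = k := fun ε => by
      rw [inner_add_left, real_inner_smul_left, hp, hu, mul_zero, add_zero]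
    have hlim : ∀ j, Filter.Tendsto (fun ε : ℝ => (inner ℝ (p + ε • u) (P.root j) : ℝ))
        (nhdsWithin 0 (Set.Ioi 0)) (nhds (inner ℝ p (P.root j))) := fun j => by
      have hc : Continuous fun ε : ℝ => (inner ℝ (p + ε • u) (P.root j) : ℝ) := by fun_prop
      simpa using (hc.tendsto 0).mono_left nhdsWithin_le_nhds
    have hlow : ∀ j, ∀ᶠ ε : ℝ in nhdsWithin 0 (Set.Ioi 0),
        (shi P a j : ℝ) ≤ inner ℝ (p + ε • u) (P.root j) := by
      intro j
      by_cases hs : SameHyperplane P i k j (shi P a j)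
      · exact Filter.Eventually.of_forall fun ε => (hs.inner_eq (hH ε)).ge
      · have h1 := pos_of_mul_pos_right (hside j _ hs) (sub_pos.2 (shi_lt_inner ha j)).le
        exact ((hlim j).eventually (lt_mem_nhds (sub_pos.1 h1))).mono fun ε h => h.le
    have hupp : ∀ j, ∀ᶠ ε : ℝ in nhdsWithin 0 (Set.Ioi 0),
        (inner ℝ (p + ε • u) (P.root j) : ℝ) ≤ shi P a j + 1 := by
      intro j
      by_cases hs : SameHyperplane P i k j (shi P a j + 1)
      · exact Filter.Eventually.of_forall fun ε => by
          rw [hs.inner_eq (hH ε)]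
          push_cast
          rfl
      · have h1 := hside j _ hs
        have h2 := inner_lt_shi (P := P) (v := a) j
        push_cast at h1
        have h3 : (inner ℝ p (P.root j) : ℝ) < shi P a j + 1 := by
          by_contra! h
          nlinarith
        exact ((hlim j).eventually (gt_mem_nhds h3)).mono fun ε h => h.le
    filter_upwards [Filter.eventually_all.2 hlow, Filter.eventually_all.2 hupp] with ε h1 h2
    exact mem_closure_shi_fiber ha fun j => ⟨h1 j, h2 j⟩
  refine le_antisymm (affineSpan_le.2 Set.inter_subset_left) fun v hv => ?_
  have hu : (inner ℝ (v - p) (P.root i) : ℝ) = 0 := by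
    rw [inner_sub_left, hp, mem_hyperplane.1 hv, sub_self]
  obtain ⟨ε, hε, hε0⟩ := ((key _ hu).and self_mem_nhdsWithin).exists
  have hpm : p ∈ closure {v | v ∈ regularSet P ∧ shi P v = shi P a} := by
    obtain ⟨δ, hδ⟩ := (key 0 (inner_zero_left _)).exists
    simpa using hδ
  have hq : (inner ℝ (p + ε • (v - p)) (P.root i) : ℝ) = k := by
    rw [inner_add_left, real_inner_smul_left, hp, hu, mul_zero, add_zero]
  have hmem := AffineMap.lineMap_mem (ε⁻¹)
    (subset_affineSpan ℝ ((hyperplane (P.root i) k : Set E) ∩ _) ⟨hp, hpm⟩)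
    (subset_affineSpan ℝ ((hyperplane (P.root i) k : Set E) ∩ _) ⟨hq, hε⟩)
  convert hmem using 1
  rw [AffineMap.lineMap_apply, vsub_eq_sub, vadd_eq_add, add_sub_cancel_left, smul_smul,
    inv_mul_cancel₀ (ne_of_gt hε0), one_smul, sub_add_cancel]

/-- Distinct alcoves are separated by a wall of the first one. -/
theorem IsAlcove.exists_isWall_separates [Finite ι] [CompleteSpace E] [P.IsReduced] {A : Set E}
    (hA : IsAlcove P A) {a b : E} (ha : a ∈ A) (hb : b ∈ regularSet P)
    (hne : shi P a ≠ shi P b) :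
    ∃ (i : ι) (k : ℤ), IsWall A (hyperplane (P.root i) k) ∧ Separates P i k a b := by
  have hAo : IsOpen A := by
    rw [hA.eq_shi_fiber ha]
    exact isOpen_shi_fiber _
  obtain ⟨c, hc, hgen⟩ := exists_generic_point (P := P) hb hAo ⟨a, ha⟩
  have hcr := hA.subset_regularSet hc
  have hca : shi P a = shi P c := by
    rw [hA.eq_shi_fiber ha] at hc
    exact hc.2.symm
  have hFne : {x : ι × ℤ | Separates P x.1 x.2 c b}.Nonempty := by
    obtain ⟨i, hi⟩ := Function.ne_iff.1 hne
    rw [hca] at hi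
    obtain ⟨k, hk⟩ := exists_separates_of_shi_ne hcr hb hi
    exact ⟨(i, k), hk⟩
  -- The parameter at which the segment from `c` to `b` meets the hyperplane. The first one met will
  -- be the wall.
  let τ : ι × ℤ → ℝ := fun x => (inner ℝ c (P.root x.1) - x.2) /
    ((inner ℝ c (P.root x.1) - x.2) - (inner ℝ b (P.root x.1) - x.2))
  obtain ⟨⟨i, k⟩, hik, hmin⟩ := Set.exists_min_image _ τ (finite_separates hcr hb) hFne
  have hmin' : ∀ (j : ι) (m : ℤ), Separates P j m c b → τ (i, k) ≤ τ (j, m) :=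
    fun j m h => hmin (j, m) h
  replace hik : Separates P i k c b := hik
  have hτ : ∀ (j : ι) (m : ℤ), Separates P j m c b → 0 < τ (j, m) ∧ τ (j, m) < 1 ∧
      (inner ℝ c (P.root j) - m : ℝ) = τ (j, m) *
        ((inner ℝ c (P.root j) - m) - (inner ℝ b (P.root j) - m)) := by
    intro j m h
    simp only [τ]
    rw [Separates] at h
    generalize (inner ℝ c (P.root j) - m : ℝ) = X at *
    generalize (inner ℝ b (P.root j) - m : ℝ) = Y at *
    rcases mul_neg_iff.1 h with ⟨hX, hY⟩ | ⟨hX, hY⟩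
    · have : 0 < X - Y := by linarith
      refine ⟨div_pos hX this, (div_lt_one this).2 (by linarith), ?_⟩
      rw [div_mul_cancel₀ _ this.ne']
    · have : X - Y < 0 := by linarith
      refine ⟨div_pos_of_neg_of_neg hX this, (div_lt_one_of_neg this).2 (by linarith), ?_⟩
      rw [div_mul_cancel₀ _ this.ne]
  obtain ⟨h0, h1, hp⟩ := hτ i k hik
  set t := τ (i, k)
  have hlev : ∀ (j : ι) (m : ℤ), (inner ℝ (c + t • (b - c)) (P.root j) - m : ℝ) =
      (inner ℝ c (P.root j) - m) - t *
        ((inner ℝ c (P.root j) - m) - (inner ℝ b (P.root j) - m)) := by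
    intro j m
    rw [inner_add_left, real_inner_smul_left, inner_sub_left]
    ring
  refine ⟨i, k, ?_, ?_⟩
  · rw [hA.eq_shi_fiber hc]
    refine isWall_of_mem hcr (p := c + t • (b - c)) ?_ ?_
    · have := hlev i k
      rw [← hp, sub_self, sub_eq_zero] at this
      exact this
    · intro j m hs
      by_contra! hle
      rw [hlev] at hle
      have hX := pow_pos (abs_pos.2 (sub_ne_zero.2 (hcr j m))) 2
      rw [sq_abs] at hX
      have hsep : Separates P j m c b := by
        rw [Separates]
        by_contra! hnn
        nlinarith
      obtain ⟨h2, h3, h4⟩ := hτ j m hsep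
      have h5 := hmin' j m hsep
      refine hs (hgen i k j m ?_)
      -- A second hyperplane that does not have `c` and the crossing point strictly on one side is
      -- met no later than `t`, so exactly at `t` by minimality; genericity then identifies it with
      -- the first.
      have h6 : t = τ (j, m) := by
        refine le_antisymm h5 ?_
        rw [Separates] at hsep
        by_contra! hlt
        have h7 : 0 < (inner ℝ c (P.root j) - m : ℝ) *
            ((inner ℝ c (P.root j) - m) - (inner ℝ b (P.root j) - m)) := by nlinarith
        have h8 := mul_pos (sub_pos.2 hlt) h7
        have h9 : (τ (j, m) - t) * ((inner ℝ c (P.root j) - m : ℝ) *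
            ((inner ℝ c (P.root j) - m) - (inner ℝ b (P.root j) - m))) ≤ 0 := by
          linear_combination hle - (inner ℝ c (P.root j) - m : ℝ) * h4
        linarith
      rw [← h6] at h4
      generalize (inner ℝ c (P.root j) - m : ℝ) = X at *
      generalize (inner ℝ b (P.root j) - m : ℝ) = Y at *
      generalize (inner ℝ c (P.root i) - k : ℝ) = X' at *
      generalize (inner ℝ b (P.root i) - k : ℝ) = Y' at *
      have h8 : t * (X' * Y - X * Y') = 0 := by
        linear_combination X' * h4 - X * hp
      have := (mul_eq_zero.1 h8).resolve_left h0.ne'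
      linarith
  · rwa [separates_iff_shi (hA.subset_regularSet ha) hb, hca, ← separates_iff_shi hcr hb]

end ExistsWall

/-! ### Exchange property and the length formula. -/

section LengthFormula

variable {ι E N : Type*} [NormedAddCommGroup E] [InnerProductSpace ℝ E]
  [AddCommGroup N] [Module ℝ N] {P : RootPairing ι ℝ E N}
  [P.IsCrystallographic] [P.IsReduced] (hP : IsEuclidean P) {A : Set E}
  (hA : IsAlcove P A) {a : E} (ha : a ∈ A)

omit [P.IsCrystallographic] [P.IsReduced] in
theorem mul_self_of_mem_simpleReflections {s : E ≃ᵃⁱ[ℝ] E} (hs : s ∈ simpleReflections P A) :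
    s * s = 1 := by
  obtain ⟨j, m, -, rfl⟩ := hs
  exact affineReflection_mul_self (P.ne_zero j) m

omit [P.IsCrystallographic] [P.IsReduced] in
theorem length_prod_le {l : List (E ≃ᵃⁱ[ℝ] E)} (hl : ∀ s ∈ l, s ∈ simpleReflections P A) :
    length P A l.prod ≤ l.length :=
  Nat.sInf_le ⟨l, hl, rfl, rfl⟩

omit [P.IsCrystallographic] [P.IsReduced] in
theorem exists_reduced_word {l : List (E ≃ᵃⁱ[ℝ] E)} (hl : ∀ s ∈ l, s ∈ simpleReflections P A) :
    ∃ l' : List (E ≃ᵃⁱ[ℝ] E), (∀ s ∈ l', s ∈ simpleReflections P A) ∧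
      l'.length = length P A l.prod ∧ l'.prod = l.prod :=
  Nat.sInf_mem (s := {n | ∃ l' : List (E ≃ᵃⁱ[ℝ] E), (∀ s ∈ l', s ∈ simpleReflections P A) ∧
    l'.length = n ∧ l'.prod = l.prod}) ⟨_, l, hl, rfl, rfl⟩

omit [P.IsCrystallographic] [P.IsReduced] in
theorem exists_word_of_mem_closure {w : E ≃ᵃⁱ[ℝ] E}
    (hw : w ∈ Subgroup.closure (simpleReflections P A)) :
    ∃ l : List (E ≃ᵃⁱ[ℝ] E), (∀ s ∈ l, s ∈ simpleReflections P A) ∧ l.prod = w := by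
  rw [← Subgroup.mem_toSubmonoid, Subgroup.closure_toSubmonoid] at hw
  obtain ⟨l, hl, rfl⟩ := Submonoid.exists_list_of_mem_closure hw
  refine ⟨l, fun s hs => ?_, rfl⟩
  rcases hl s hs with h | h
  · exact h
  · have h : s⁻¹ ∈ simpleReflections P A := h
    have e := inv_eq_of_mul_eq_one_left (mul_self_of_mem_simpleReflections h)
    rw [inv_inv] at e
    rwa [← e] at h

include hP

include hA ha

/-- The strong exchange property. -/
theorem exists_word_of_separates {l : List (E ≃ᵃⁱ[ℝ] E)}
    (hl : ∀ s ∈ l, s ∈ simpleReflections P A) {i : ι} {k : ℤ} (hs : Separates P i k a (l.prod a)) :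
    ∃ l' : List (E ≃ᵃⁱ[ℝ] E), (∀ s ∈ l', s ∈ simpleReflections P A) ∧
      l'.length + 1 = l.length ∧ l'.prod = affineReflection (P.root i) k * l.prod := by
  induction l generalizing i k with
  | nil =>
    exact absurd hs (not_lt.2 (mul_self_nonneg _))
  | cons s l ih =>
    have hl' : ∀ t ∈ l, t ∈ simpleReflections P A := fun t ht => hl t (List.mem_cons_of_mem _ ht)
    have hsS := hl s List.mem_cons_self
    obtain ⟨j, m, hw, rfl⟩ := hsS
    have har := hA.subset_regularSet ha
    rw [List.prod_cons] at hs ⊢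
    -- Either the hyperplane is the wall of the first letter, which is then deleted, or it is
    -- crossed after the first letter, and its mirror image is handled by induction on the remaining
    -- word.
    by_cases hsep : Separates P i k a (affineReflection (P.root j) m a)
    · refine ⟨l, hl', rfl, ?_⟩
      rw [(IsWall.sameHyperplane hP hA ha hw hsep).affineReflection_eq,
        affineReflection_mul_mul_cancel (P.ne_zero j)]
    · have h := separates_trans_left (affineReflection_mem_regularSet hP har) hs hsep
      change Separates P i k _ (affineReflection (P.root j) m (l.prod a)) at h
      rw [separates_affineReflection hP] at h
      obtain ⟨l', h1, h2, h3⟩ := ih hl' h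
      refine ⟨affineReflection (P.root j) m :: l', ?_, by simp [h2], ?_⟩
      · simpa using ⟨⟨j, m, hw, rfl⟩, h1⟩
      · rw [List.prod_cons, h3, ← affineReflection_conj hP, mul_assoc, mul_assoc,
          affineReflection_mul_mul_cancel (P.ne_zero j)]

/-- If `s l` fixes the alcove, the wall of `s` separates `a` from `l a`. By exchange, `s l` is then
represented by a word two letters shorter, and induction applies. -/
theorem prod_eq_one_of_shi_eq {l : List (E ≃ᵃⁱ[ℝ] E)} (hl : ∀ s ∈ l, s ∈ simpleReflections P A)
    (hreg : l.prod a ∈ regularSet P) (h : shi P a = shi P (l.prod a)) : l.prod = 1 := by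
  induction hn : l.length using Nat.strong_induction_on generalizing l with
  | _ n ih =>
    rcases l with - | ⟨s, l⟩
    · rfl
    have hl' : ∀ t ∈ l, t ∈ simpleReflections P A := fun t ht => hl t (List.mem_cons_of_mem _ ht)
    have hsS := hl s List.mem_cons_self
    obtain ⟨j, m, hw, rfl⟩ := hsS
    have har := hA.subset_regularSet ha
    have h1 := IsWall.separates_affineReflection_self hP hA ha hw
    have h2 := separates_trans_left hreg h1 (not_separates_of_shi_eq har hreg h j m)
    rw [List.prod_cons] at h2
    change Separates P j m (affineReflection (P.root j) m (l.prod a)) _ at h2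
    rw [separates_affineReflection hP] at h2
    -- A hyperplane is its own mirror image, but the root is negated and the level becomes `m - 2m =
    -- -m`.
    have hsame : SameHyperplane P j m (P.reflectionPerm j j) (reflectLevel P j m j m) := by
      refine Or.inr ⟨by simp, ?_⟩
      rw [reflectLevel, P.pairingIn_same]
      ring
    rw [hsame.separates_iff, separates_comm] at h2
    obtain ⟨l', h3, h4, h5⟩ := exists_word_of_separates hP hA ha hl' h2
    rw [← List.prod_cons] at h5
    rw [← h5] at hreg h ⊢
    refine ih l'.length ?_ h3 hreg h rfl
    rw [← hn, List.length_cons]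
    omega

variable [Finite ι] [CompleteSpace E]

/-- Every reflection is a product of reflections in the walls of the alcove. -/
theorem affineReflection_mem_closure (i : ι) (k : ℤ) :
    affineReflection (P.root i) k ∈ Subgroup.closure (simpleReflections P A) := by
  have := Fintype.ofFinite ι
  have har := hA.subset_regularSet ha
  induction hn : shiDist P a (affineReflection (P.root i) k a) using Nat.strong_induction_on
    generalizing i k with
  | _ n ih =>
    set t := affineReflection (P.root i) k with ht
    have htr : t a ∈ regularSet P := affineReflection_mem_regularSet hP har
    have hsep : Separates P i k a (t a) := by
      rw [Separates, ht, inner_affineReflection_self (P.ne_zero i)]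
      have := pow_pos (abs_pos.2 (sub_ne_zero.2 (har i k))) 2
      rw [sq_abs] at this
      nlinarith
    have hne : shi P a ≠ shi P (t a) := fun h => not_separates_of_shi_eq har htr h i k hsep
    obtain ⟨j, m, hw, hjm⟩ := hA.exists_isWall_separates ha htr hne
    set s := affineReflection (P.root j) m with hs
    have hsS : s ∈ Subgroup.closure (simpleReflections P A) :=
      Subgroup.subset_closure ⟨j, m, hw, rfl⟩
    have hsr : s a ∈ regularSet P := affineReflection_mem_regularSet hP har
    have htsr : t (s a) ∈ regularSet P := affineReflection_mem_regularSet hP hsr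
    by_cases hik : Separates P i k a (s a)
    · rw [ht, (IsWall.sameHyperplane hP hA ha hw hik).affineReflection_eq]
      exact hsS
    -- Otherwise `t` maps `H_{j,m}` to itself. If it keeps the sides, `H_{j,m}` cannot separate `a`
    -- from `t a`; if it exchanges them, its fixed hyperplane is `H_{j,m}`, against `hik`.
    have hnot : ¬ Separates P j m (t a) (t (s a)) := by
      intro h
      rw [ht, separates_affineReflection hP] at h
      rcases IsWall.sameHyperplane hP hA ha hw h with ⟨h1, h2⟩ | ⟨h1, h2⟩
      · rw [Separates, ht, inner_affineReflection_sub_level hP, h1, h2] at hjm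
        exact absurd hjm (not_lt.2 (mul_self_nonneg _))
      · have hsame : SameHyperplane P i k j m := sameHyperplane_of_subset fun v hv => by
          have h3 := inner_affineReflection_sub_level hP i k v j m
          rw [affineReflection_apply_eq_self hv, h1, h2, inner_neg_right] at h3
          push_cast at h3
          linarith
        rw [← hsame.separates_iff] at hik
        exact hik (IsWall.separates_affineReflection_self hP hA ha hw)
    have hjm' : Separates P j m a (t (s a)) := by
      by_contra h
      exact hnot (separates_comm.1 (separates_trans_left htsr hjm h))
    -- The distance from `a` to `s t s a` equals that from `s a` to `t s a`. The identities `d1` to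
    -- `d4` show it to be `4` less than the distance from `a` to `t a`, so the conjugate `s t s`
    -- falls under the induction hypothesis.
    have d1 := IsWall.shiDist_of_separates hP hA ha hw htr hjm
    have d2 := IsWall.shiDist_of_separates hP hA ha hw htsr hjm'
    rw [← hs] at d1 d2
    have d3 : shiDist P a (t (s a)) = shiDist P (s a) (t a) := by
      rw [← shiDist_affineReflection hP i k, affineReflection_apply_self (P.ne_zero i),
        shiDist_comm]
    have hconj : s * (t * s) = affineReflection (P.root (P.reflectionPerm j i))
        (reflectLevel P j m i k) := affineReflection_conj hP j m i k
    have d4 : shiDist P a (affineReflection (P.root (P.reflectionPerm j i))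
        (reflectLevel P j m i k) a) = shiDist P (s a) (t (s a)) := by
      rw [← hconj]
      change shiDist P a (s (t (s a))) = _
      rw [← shiDist_affineReflection hP j m, affineReflection_apply_self (P.ne_zero j)]
    have hmem := ih _ (by omega) (P.reflectionPerm j i) (reflectLevel P j m i k) rfl
    rw [← hconj] at hmem
    have h4 := mul_mem (mul_mem hsS hmem) hsS
    have hss : s * s = 1 := affineReflection_mul_self (P.ne_zero j) m
    rwa [← mul_assoc, hss, one_mul, mul_assoc, hss, mul_one] at h4

theorem exists_word_of_mem_affineWeylGroup {w : E ≃ᵃⁱ[ℝ] E} (hw : w ∈ affineWeylGroup P) :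
    ∃ l : List (E ≃ᵃⁱ[ℝ] E), (∀ s ∈ l, s ∈ simpleReflections P A) ∧ l.prod = w := by
  refine exists_word_of_mem_closure ((Subgroup.closure_le _).2 ?_ hw)
  rintro _ ⟨i, k, rfl⟩
  exact affineReflection_mem_closure hP hA ha i k

-- Applying the first letter to both points turns it into a wall crossing at `a`, which changes
-- `shiDist` by exactly `2`.
omit [Finite ι] [CompleteSpace E] in
theorem shiDist_prod_le [Fintype ι] {l : List (E ≃ᵃⁱ[ℝ] E)}
    (hl : ∀ s ∈ l, s ∈ simpleReflections P A) :
    l.prod a ∈ regularSet P ∧ shiDist P a (l.prod a) ≤ 2 * l.length := by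
  have har := hA.subset_regularSet ha
  induction l with
  | nil => exact ⟨har, (shiDist_eq_zero_iff.2 rfl).le⟩
  | cons s l ih =>
    obtain ⟨hr, ih⟩ := ih fun t ht => hl t (List.mem_cons_of_mem _ ht)
    obtain ⟨j, m, hw, rfl⟩ := hl s List.mem_cons_self
    rw [List.prod_cons, List.length_cons]
    change affineReflection (P.root j) m (l.prod a) ∈ _ ∧
      shiDist P a (affineReflection (P.root j) m (l.prod a)) ≤ _
    refine ⟨affineReflection_mem_regularSet hP hr, ?_⟩
    rw [← shiDist_affineReflection hP j m, affineReflection_apply_self (P.ne_zero j)]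
    by_cases h : Separates P j m a (l.prod a)
    · have := IsWall.shiDist_of_separates hP hA ha hw hr h
      omega
    · have := IsWall.shiDist_of_not_separates hP hA ha hw hr h
      omega

/-- While the image differs from the base alcove, multiplying by the reflection in a separating wall
lowers `shiDist` by `2`; the process ends at the identity. -/
theorem exists_word_length_eq [Fintype ι] {l : List (E ≃ᵃⁱ[ℝ] E)}
    (hl : ∀ s ∈ l, s ∈ simpleReflections P A) :
    ∃ l' : List (E ≃ᵃⁱ[ℝ] E), (∀ s ∈ l', s ∈ simpleReflections P A) ∧
      2 * l'.length = shiDist P a (l.prod a) ∧ l'.prod = l.prod := by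
  have har := hA.subset_regularSet ha
  induction hn : shiDist P a (l.prod a) using Nat.strong_induction_on generalizing l with
  | _ n ih =>
    have hr := (shiDist_prod_le hP hA ha hl).1
    by_cases h : shi P a = shi P (l.prod a)
    · refine ⟨[], by simp, ?_, (prod_eq_one_of_shi_eq hP hA ha hl hr h).symm⟩
      rw [← hn, shiDist_eq_zero_iff.2 h]
      rfl
    · obtain ⟨j, m, hw, hs⟩ := hA.exists_isWall_separates ha hr h
      have d1 := IsWall.shiDist_of_separates hP hA ha hw hr hs
      have d2 : shiDist P a ((affineReflection (P.root j) m :: l).prod a) =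
          shiDist P (affineReflection (P.root j) m a) (l.prod a) := by
        rw [List.prod_cons, ← shiDist_affineReflection hP j m]
        change shiDist P _ (affineReflection (P.root j) m
          (affineReflection (P.root j) m (l.prod a))) = _
        rw [affineReflection_apply_self (P.ne_zero j)]
      have hjS : affineReflection (P.root j) m ∈ simpleReflections P A := ⟨j, m, hw, rfl⟩
      obtain ⟨l', h1, h2, h3⟩ := ih _ (by omega) (List.forall_mem_cons.2 ⟨hjS, hl⟩) rfl
      refine ⟨affineReflection (P.root j) m :: l', List.forall_mem_cons.2 ⟨hjS, h1⟩, ?_, ?_⟩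
      · rw [List.length_cons]
        omega
      · rw [List.prod_cons, h3, List.prod_cons, affineReflection_mul_mul_cancel (P.ne_zero j)]

/-- The length of an element is the number of hyperplanes separating the base alcove from its
image. -/
theorem two_mul_length [Fintype ι] {w : E ≃ᵃⁱ[ℝ] E} (hw : w ∈ affineWeylGroup P) :
    2 * length P A w = shiDist P a (w a) := by
  obtain ⟨l, hl, rfl⟩ := exists_word_of_mem_affineWeylGroup hP hA ha hw
  obtain ⟨l₁, h1, h2, h3⟩ := exists_reduced_word hl
  obtain ⟨l₂, h4, h5, h6⟩ := exists_word_length_eq hP hA ha hl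
  have h7 := (shiDist_prod_le hP hA ha h1).2
  have h8 := length_prod_le h4
  rw [h3] at h7
  rw [h6] at h8
  omega

theorem length_affineReflection_mul_lt {w : E ≃ᵃⁱ[ℝ] E} (hw : w ∈ affineWeylGroup P)
    {i : ι} {k : ℤ} (h : Separates P i k a (w a)) :
    length P A (affineReflection (P.root i) k * w) < length P A w := by
  obtain ⟨l, hl, rfl⟩ := exists_word_of_mem_affineWeylGroup hP hA ha hw
  obtain ⟨l₁, h1, h2, h3⟩ := exists_reduced_word hl
  rw [← h3] at h ⊢
  obtain ⟨l₂, h4, h5, h6⟩ := exists_word_of_separates hP hA ha h1 h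
  rw [← h6]
  have := length_prod_le h4
  rw [← h3] at h2
  omega

end LengthFormula

/-! ### Adjacent parallel hyperplanes as consecutive levels of one root. -/

section Strips

variable {ι E N : Type*} [NormedAddCommGroup E] [InnerProductSpace ℝ E]
  [AddCommGroup N] [Module ℝ N] {P : RootPairing ι ℝ E N}

theorem exists_inner_eq {α : E} (hα : α ≠ 0) (k : ℝ) : ∃ v : E, (inner ℝ v α : ℝ) = k := by
  refine ⟨(k / inner ℝ α α : ℝ) • α, ?_⟩
  have := (inner_self_pos_of_ne_zero hα).ne'
  rw [real_inner_smul_left]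
  field_simp

theorem mul_pos_of_sSameSide {α : E} {k : ℤ} {p q : E} (h : (hyperplane α k).SSameSide p q) :
    0 < (inner ℝ p α - k : ℝ) * (inner ℝ q α - k) := by
  obtain ⟨⟨p₁, h₁, p₂, h₂, hr⟩, hp, hq⟩ := h
  rw [mem_hyperplane] at h₁ h₂ hp hq
  have hp' := sub_ne_zero.2 hp
  have hq' := sub_ne_zero.2 hq
  have e₁ : (inner ℝ p α - k : ℝ) = inner ℝ (p -ᵥ p₁) α := by
    rw [vsub_eq_sub, inner_sub_left, h₁]
  have e₂ : (inner ℝ q α - k : ℝ) = inner ℝ (q -ᵥ p₂) α := by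
    rw [vsub_eq_sub, inner_sub_left, h₂]
  rcases hr with h | h | ⟨r, s, hr, hs, h⟩
  · rw [e₁, h, inner_zero_left] at hp'
    exact absurd rfl hp'
  · rw [e₂, h, inner_zero_left] at hq'
    exact absurd rfl hq'
  · have h3 := congrArg (fun v : E => (inner ℝ v α : ℝ)) h
    simp only [real_inner_smul_left, ← e₁, ← e₂] at h3
    have h4 : r * ((inner ℝ p α - k : ℝ) * (inner ℝ q α - k)) =
        s * (inner ℝ q α - k : ℝ) ^ 2 := by
      linear_combination (inner ℝ q α - k : ℝ) * h3
    have h5 : 0 < s * (inner ℝ q α - k : ℝ) ^ 2 := mul_pos hs (by positivity)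
    rw [← h4] at h5
    exact pos_of_mul_pos_right h5 hr.le

theorem strictlyBetween_of_lt {α : E} {k l m : ℤ} (h : (k < l ∧ l < m) ∨ (m < l ∧ l < k)) :
    StrictlyBetween (hyperplane α l) (hyperplane α k) (hyperplane α m) := by
  intro p hp q hq
  rw [mem_hyperplane] at hp hq
  have hmk : (m - k : ℝ) ≠ 0 := sub_ne_zero.2 (by norm_cast; omega)
  refine ⟨Wbtw.wOppSide₁₃ (y := AffineMap.lineMap p q ((l - k : ℝ) / (m - k))) ⟨_, ?_, rfl⟩ ?_,
    ?_, ?_⟩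
  · rcases h with ⟨h1, h2⟩ | ⟨h1, h2⟩
    · have h1' : (k : ℝ) < l := by exact_mod_cast h1
      have h2' : (l : ℝ) < m := by exact_mod_cast h2
      exact ⟨div_nonneg (by linarith) (by linarith),
        (div_le_one (by linarith)).2 (by linarith)⟩
    · have h1' : (m : ℝ) < l := by exact_mod_cast h1
      have h2' : (l : ℝ) < k := by exact_mod_cast h2
      exact ⟨div_nonneg_of_nonpos (by linarith) (by linarith),
        (div_le_one_of_neg (by linarith)).2 (by linarith)⟩
  · rw [mem_hyperplane, AffineMap.lineMap_apply, vsub_eq_sub, vadd_eq_add, inner_add_left,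
      real_inner_smul_left, inner_sub_left, hp, hq]
    field_simp
    ring
  · rw [mem_hyperplane, hp]
    norm_cast
    omega
  · rw [mem_hyperplane, hq]
    norm_cast
    omega

theorem SameHyperplane.hyperplane_eq {i j : ι} {k m : ℤ} (h : SameHyperplane P i k j m) :
    hyperplane (P.root j) m = hyperplane (P.root i) k := by
  ext v
  rw [mem_hyperplane, mem_hyperplane]
  rcases h with ⟨h, rfl⟩ | ⟨h, rfl⟩
  · rw [h]
  · rw [h, inner_neg_right]
    push_cast
    exact neg_inj

/-- Parallel hyperplanes are level sets of a common root. -/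
theorem exists_sameHyperplane_of_parallel [P.IsReduced] {i j : ι} {k m : ℤ}
    (h : (hyperplane (P.root i) k).Parallel (hyperplane (P.root j) m)) :
    ∃ l, SameHyperplane P i l j m := by
  obtain ⟨v, hv⟩ := h
  have key : ∀ u : E, (inner ℝ u (P.root i) : ℝ) = k →
      (inner ℝ u (P.root j) : ℝ) = m - inner ℝ v (P.root j) := by
    intro u hu
    have hmem : v +ᵥ u ∈ hyperplane (P.root j) m := by
      rw [hv]
      exact ⟨u, hu, rfl⟩
    rw [mem_hyperplane, vadd_eq_add, inner_add_left] at hmem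
    linarith
  rcases root_eq_or_eq_neg_of_subset key with ⟨h1, -⟩ | ⟨h1, -⟩
  · exact ⟨m, Or.inl ⟨h1, rfl⟩⟩
  · exact ⟨-m, Or.inr ⟨h1, (neg_neg m).symm⟩⟩

theorem AdjacentParallel.level_eq {i : ι} {k m : ℤ}
    (h : AdjacentParallel P (hyperplane (P.root i) k) (hyperplane (P.root i) m)) :
    m = k + 1 ∨ m = k - 1 := by
  obtain ⟨-, hne, hb⟩ := h
  have hkm : m ≠ k := fun h => hne (by rw [h])
  have h1 : ¬ (k < k + 1 ∧ k + 1 < m) := fun h =>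
    hb i (k + 1) (strictlyBetween_of_lt (Or.inl h))
  have h2 : ¬ (m < k - 1 ∧ k - 1 < k) := fun h =>
    hb i (k - 1) (strictlyBetween_of_lt (Or.inr h))
  omega

/-- Three consecutive parallel hyperplanes are three consecutive level sets of some root. -/
theorem exists_consecutive_levels [P.IsReduced] {i₀ i₁ i₂ : ι} {k₀ k₁ k₂ : ℤ}
    (h₀₁ : AdjacentParallel P (hyperplane (P.root i₀) k₀) (hyperplane (P.root i₁) k₁))
    (h₁₂ : AdjacentParallel P (hyperplane (P.root i₁) k₁) (hyperplane (P.root i₂) k₂))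
    (h₀₂ : hyperplane (P.root i₀) k₀ ≠ hyperplane (P.root i₂) k₂) :
    ∃ (i : ι) (k : ℤ), SameHyperplane P i k i₀ k₀ ∧ SameHyperplane P i (k + 1) i₁ k₁ ∧
      SameHyperplane P i (k + 2) i₂ k₂ := by
  obtain ⟨l₁, hl₁⟩ := exists_sameHyperplane_of_parallel h₀₁.1
  obtain ⟨l₂, hl₂⟩ := exists_sameHyperplane_of_parallel (h₀₁.1.trans h₁₂.1)
  rw [hl₁.hyperplane_eq] at h₀₁ h₁₂
  rw [hl₂.hyperplane_eq] at h₁₂ h₀₂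
  have e₁ := h₀₁.level_eq
  have e₂ := h₁₂.level_eq
  have e₃ : l₂ ≠ k₀ := fun h => h₀₂ (by rw [h])
  rcases e₁ with e₁ | e₁
  · obtain rfl : l₂ = k₀ + 2 := by omega
    subst e₁
    exact ⟨i₀, k₀, Or.inl ⟨rfl, rfl⟩, hl₁, hl₂⟩
  · obtain rfl : l₂ = k₀ - 2 := by omega
    subst e₁
    have hneg : P.root (P.reflectionPerm i₀ i₀) = -P.root i₀ := by simp
    -- Descending levels become ascending for the negative root.
    refine ⟨P.reflectionPerm i₀ i₀, -k₀, ?_, ?_, ?_⟩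
    · exact Or.inr ⟨by rw [hneg, neg_neg], by ring⟩
    · rcases hl₁ with h | h
      · exact Or.inr ⟨by rw [h.1, hneg, neg_neg], by omega⟩
      · exact Or.inl ⟨by rw [h.1, hneg], by omega⟩
    · rcases hl₂ with h | h
      · exact Or.inr ⟨by rw [h.1, hneg, neg_neg], by omega⟩
      · exact Or.inl ⟨by rw [h.1, hneg], by omega⟩

theorem BoundedBy.inner_mem_Ioo {i : ι} {k : ℤ} {C : Set E}
    (h : BoundedBy C (hyperplane (P.root i) k) (hyperplane (P.root i) (k + 1))) {c : E}
    (hc : c ∈ C) :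
    (k : ℝ) < inner ℝ c (P.root i) ∧ (inner ℝ c (P.root i) : ℝ) < k + 1 := by
  obtain ⟨h1, h2⟩ := h c hc
  obtain ⟨p, hp⟩ := exists_inner_eq (P.ne_zero i) k
  obtain ⟨q, hq⟩ := exists_inner_eq (P.ne_zero i) (k + 1)
  have h3 := mul_pos_of_sSameSide (h1 q (by rw [mem_hyperplane, hq]; push_cast; rfl))
  have h4 := mul_pos_of_sSameSide (h2 p hp)
  rw [hq] at h3
  rw [hp] at h4
  push_cast at h4
  constructor <;> linarith

end Strips

/-! ### Comparing the translation with the opposite reflection, pair by pair. -/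

section Translation

/-- The contribution of a pair of coordinates exchanged by a reflection: translating along the
root away from the base alcove does not bring it closer, and if the distance does not change then
reflecting in the other direction does not change it either. -/
theorem natAbs_pair_translation {x x' b b' c K L : ℤ} (hc : 0 ≤ c) (h1 : K ≤ x - x')
    (h2 : x - x' ≤ K + c) (h3 : b - b' ≤ L + c) (h4 : L = K ∨ L + c ≤ K) :
    (x - b).natAbs + (x' - b').natAbs ≤ (x + c - b).natAbs + (x' - c - b').natAbs ∧
    ((x + c - b).natAbs + (x' - c - b').natAbs = (x - b).natAbs + (x' - b').natAbs →
      (x' + K - b).natAbs + (x - K - b').natAbs = (x - b).natAbs + (x' - b').natAbs) := by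
  -- Put `S = (x - b) + (x' - b')` and `D = (x - b) - (x' - b')`; the sum of absolute values is `max
  -- |S| |D|`. Translation keeps `S` and sends `D ≥ -c` to `D + 2c`. Reflection keeps `S` and gives
  -- `D' = D - 2(x - x' - K)`, with `-(D + 2c) ≤ D' ≤ D`. If translation preserves the maximum, then
  -- either `|S| ≥ D + 2c`, which bounds `|D|` and `|D'|`, or `|D + 2c| = |D|`, which forces `x - x'
  -- = K` and `D' = D`.
  omega

variable {ι E N : Type*} [NormedAddCommGroup E] [InnerProductSpace ℝ E]
  [AddCommGroup N] [Module ℝ N] {P : RootPairing ι ℝ E N}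

/-- The contribution of the root `j` and its reflection in the root `i` to `shiDist`. -/
def pairDist (P : RootPairing ι ℝ E N) (i : ι) (p q : E) (j : ι) : ℕ :=
  (shi P q j - shi P p j).natAbs +
    (shi P q (P.reflectionPerm i j) - shi P p (P.reflectionPerm i j)).natAbs

theorem sum_pairDist [Fintype ι] (i : ι) (p q : E) :
    ∑ j, pairDist P i p q j = 2 * shiDist P p q := by
  simp only [pairDist]
  rw [Finset.sum_add_distrib,
    Equiv.sum_comp (P.reflectionPerm i) fun j => (shi P q j - shi P p j).natAbs, shiDist_comm,
    shiDist, two_mul]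

theorem pairDist_reflectionPerm (i : ι) (p q : E) (j : ι) :
    pairDist P i p q (P.reflectionPerm i j) = pairDist P i p q j := by
  rw [pairDist, P.reflectionPerm_self, add_comm, pairDist]

variable [P.IsCrystallographic]

theorem pairingIn_reflectionPerm_left (i j : ι) :
    P.pairingIn ℤ (P.reflectionPerm i j) i = -P.pairingIn ℤ j i := by
  have h : P.pairing (P.reflectionPerm i j) i = -P.pairing j i := by
    rw [← P.pairing_reflectionPerm, P.pairing_reflectionPerm_self_right]
  rw [← P.algebraMap_pairingIn ℤ, ← P.algebraMap_pairingIn ℤ] at h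
  simp only [algebraMap_int_eq, eq_intCast] at h
  exact_mod_cast h

/-- The real values differ by `c ⟪v, α⟫`, with `c` the pairing. This lies between `c` times the
floor of `⟪v, α⟫` and `c` more; taking floors costs less than one, which integrality absorbs. -/
theorem shi_sub_shi_reflectionPerm {v : E} (hv : v ∈ regularSet P) (i j : ι)
    (hc : 0 ≤ P.pairingIn ℤ j i) :
    shi P v i * P.pairingIn ℤ j i ≤ shi P v j - shi P v (P.reflectionPerm i j) ∧
      shi P v j - shi P v (P.reflectionPerm i j) ≤
        shi P v i * P.pairingIn ℤ j i + P.pairingIn ℤ j i := by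
  have h1 := shi_lt_inner hv i
  have h2 := inner_lt_shi (P := P) (v := v) i
  have h3 := shi_lt_inner hv j
  have h4 := inner_lt_shi (P := P) (v := v) j
  have h5 := shi_lt_inner hv (P.reflectionPerm i j)
  have h6 := inner_lt_shi (P := P) (v := v) (P.reflectionPerm i j)
  have h7 : (inner ℝ v (P.root (P.reflectionPerm i j)) : ℝ) =
      inner ℝ v (P.root j) - P.pairingIn ℤ j i * inner ℝ v (P.root i) := by
    rw [root_reflectionPerm_eq_pairingIn, inner_sub_right, real_inner_smul_right]
  have hc' : (0 : ℝ) ≤ P.pairingIn ℤ j i := by exact_mod_cast hc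
  have h8 := mul_le_mul_of_nonneg_right h1.le hc'
  have h9 := mul_le_mul_of_nonneg_right h2.le hc'
  constructor
  · have : (shi P v i * P.pairingIn ℤ j i : ℝ) < shi P v j - shi P v (P.reflectionPerm i j) + 1 := by
      linarith
    have h10 : shi P v i * P.pairingIn ℤ j i < shi P v j - shi P v (P.reflectionPerm i j) + 1 := by
      exact_mod_cast this
    omega
  · have : (shi P v j - shi P v (P.reflectionPerm i j) : ℝ) <
        shi P v i * P.pairingIn ℤ j i + P.pairingIn ℤ j i + 1 := by
      linarith
    have h10 : shi P v j - shi P v (P.reflectionPerm i j) <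
        shi P v i * P.pairingIn ℤ j i + P.pairingIn ℤ j i + 1 := by
      exact_mod_cast this
    omega

variable (hP : IsEuclidean P)
include hP

theorem shi_translation (i : ι) (k : ℤ) (v : E) (j : ι) :
    shi P (affineReflection (P.root i) (k + 2) (affineReflection (P.root i) (k + 1) v)) j =
      shi P v j + P.pairingIn ℤ j i := by
  rw [shi_affineReflection hP, shi_affineReflection hP, P.reflectionPerm_self,
    pairingIn_reflectionPerm_left]
  ring

theorem pairDist_translation {a v : E} (ha : a ∈ regularSet P) (hv : v ∈ regularSet P) {i : ι}
    (hle : shi P a i ≤ shi P v i) (j : ι) :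
    pairDist P i a v j ≤ pairDist P i a (affineReflection (P.root i) (shi P v i + 2)
      (affineReflection (P.root i) (shi P v i + 1) v)) j ∧
    (pairDist P i a (affineReflection (P.root i) (shi P v i + 2)
      (affineReflection (P.root i) (shi P v i + 1) v)) j = pairDist P i a v j →
      pairDist P i a (affineReflection (P.root i) (shi P v i) v) j = pairDist P i a v j) := by
  -- Exchanging the members of a pair negates the pairing with `i`.
  wlog hc : 0 ≤ P.pairingIn ℤ j i generalizing j
  · have h := this (P.reflectionPerm i j) (by rw [pairingIn_reflectionPerm_left]; omega)
    simpa only [pairDist_reflectionPerm] using h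
  obtain ⟨h1, h2⟩ := shi_sub_shi_reflectionPerm hv i j hc
  have h3 := (shi_sub_shi_reflectionPerm ha i j hc).2
  have h5 : shi P a i * P.pairingIn ℤ j i = shi P v i * P.pairingIn ℤ j i ∨
      shi P a i * P.pairingIn ℤ j i + P.pairingIn ℤ j i ≤ shi P v i * P.pairingIn ℤ j i := by
    rcases hle.eq_or_lt with h | h
    · exact Or.inl (by rw [h])
    · have := mul_le_mul_of_nonneg_right (Int.add_one_le_of_lt h) hc
      rw [add_mul, one_mul] at this
      exact Or.inr this
  have h := natAbs_pair_translation hc h1 h2 h3 h5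
  simp only [pairDist, shi_translation hP, shi_affineReflection hP, P.reflectionPerm_self,
    pairingIn_reflectionPerm_left, mul_neg, ← sub_eq_add_neg]
  exact h

variable [P.IsReduced] {A : Set E} (hA : IsAlcove P A) {a : E} (ha : a ∈ A) [Finite ι]
  [CompleteSpace E]
include hA ha

/-- If translating an alcove along a root across two consecutive hyperplanes increases the length
by two, the first reflection increasing it, then reflecting it in the opposite bounding hyperplane changes the length
by one. -/
theorem length_reflection_of_translation {i : ι} {k : ℤ} {x : E ≃ᵃⁱ[ℝ] E}
    (hx : x ∈ affineWeylGroup P) (hk : shi P (x a) i = k)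
    (hlt : length P A x < length P A (affineReflection (P.root i) (k + 1) * x))
    (hlen : length P A (affineReflection (P.root i) (k + 2) *
      affineReflection (P.root i) (k + 1) * x) = length P A x + 2) :
    length P A (affineReflection (P.root i) k * x) = length P A x + 1 ∨
      length P A (affineReflection (P.root i) k * x) + 1 = length P A x := by
  have := Fintype.ofFinite ι
  have hmem : ∀ m : ℤ, affineReflection (P.root i) m ∈ affineWeylGroup P := fun m =>
    Subgroup.subset_closure ⟨i, m, rfl⟩
  have har := hA.subset_regularSet ha
  have hvr : x a ∈ regularSet P := by
    obtain ⟨l, hl, rfl⟩ := exists_word_of_mem_affineWeylGroup hP hA ha hx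
    exact (shiDist_prod_le hP hA ha hl).1
  -- Otherwise `H_{k+1}` separates `a` from `x a`, and reflecting in it would shorten `x`.
  have hle : shi P a i ≤ shi P (x a) i := by
    by_contra! hgt
    refine absurd (length_affineReflection_mul_lt hP hA ha hx (i := i) (k := k + 1) ?_)
      (not_lt.2 hlt.le)
    rw [separates_iff_shi har hvr]
    omega
  have e0 := two_mul_length hP hA ha hx
  have e1 := two_mul_length hP hA ha (mul_mem (hmem k) hx)
  have e2 := two_mul_length hP hA ha (mul_mem (mul_mem (hmem (k + 2)) (hmem (k + 1))) hx)
  have hpair := pairDist_translation hP har hvr hle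
  change _ = shiDist P a (affineReflection (P.root i) k (x a)) at e1
  change _ = shiDist P a (affineReflection (P.root i) (k + 2)
    (affineReflection (P.root i) (k + 1) (x a))) at e2
  subst hk
  set v := x a
  set v₀ := affineReflection (P.root i) (shi P v i) v with hv₀
  set v₂ := affineReflection (P.root i) (shi P v i + 2)
    (affineReflection (P.root i) (shi P v i + 1) v) with hv₂
  have hneg : P.root (P.reflectionPerm i i) = -P.root i := by simp
  have hne : i ≠ P.reflectionPerm i i := fun h => root_ne_neg (P := P) i (by rw [← hneg, ← h])
  -- The pairing of `i` with itself is `2`, so translation moves the coordinates of `i` and of its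
  -- negative by two each, both away from those of `a`.
  have d2 : (pairDist P i a v₂ i : ℤ) - pairDist P i a v i = 4 := by
    simp only [pairDist, hv₂, shi_translation hP, pairingIn_reflectionPerm_left,
      P.pairingIn_same, shi_of_root_eq_neg hvr hneg, shi_of_root_eq_neg har hneg]
    omega
  have d0 : (pairDist P i a v₀ i : ℤ) - pairDist P i a v i = 2 ∨
      (pairDist P i a v₀ i : ℤ) - pairDist P i a v i = -2 := by
    simp only [pairDist, hv₀, shi_affineReflection hP, pairingIn_reflectionPerm_left,
      P.pairingIn_same, P.reflectionPerm_self, shi_of_root_eq_neg hvr hneg,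
      shi_of_root_eq_neg har hneg]
    omega
  have s0 := sum_pairDist (P := P) i a v
  have s1 := sum_pairDist (P := P) i a v₀
  have s2 := sum_pairDist (P := P) i a v₂
  -- `pairDist` sums to four times the length, and the length grows by two.
  have htot : ∑ j, ((pairDist P i a v₂ j : ℤ) - pairDist P i a v j) = 8 := by
    rw [Finset.sum_sub_distrib, ← Nat.cast_sum, ← Nat.cast_sum]
    omega
  -- The indices `i` and `-i` already contribute `4 + 4 = 8`, and no term is negative, so all other
  -- pairs are unchanged by the translation and hence by the reflection.
  have hzero : ∀ j, j ≠ i ∧ j ≠ P.reflectionPerm i i →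
      (pairDist P i a v₀ j : ℤ) - pairDist P i a v j = 0 := by
    rintro j ⟨hj, hj'⟩
    classical
    have hsub := Finset.sum_le_univ_sum_of_nonneg
      (f := fun j => (pairDist P i a v₂ j : ℤ) - pairDist P i a v j)
      (s := {j, i, P.reflectionPerm i i}) fun j => by
        have := (hpair j).1
        omega
    rw [htot, Finset.sum_insert (by simp [hj, hj']), Finset.sum_pair hne,
      pairDist_reflectionPerm, pairDist_reflectionPerm, d2] at hsub
    have h1 := hpair j
    have h2 := h1.2 (by omega)
    omega
  have htot0 := Fintype.sum_eq_add i (P.reflectionPerm i i) hne hzero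
  rw [Finset.sum_sub_distrib, ← Nat.cast_sum, ← Nat.cast_sum, pairDist_reflectionPerm,
    pairDist_reflectionPerm] at htot0
  omega

end Translation


end AffineCoxeter

end

/-! ### Reduction of the theorem to levels `k`, `k + 1`, `k + 2` of one root. -/

theorem theorem1p3 {ι E N : Type*} [Finite ι]
    [NormedAddCommGroup E] [InnerProductSpace ℝ E] (hE : Module.finrank ℝ E = 2)
    [AddCommGroup N] [Module ℝ N]
    (P : RootPairing ι ℝ E N) [P.IsRootSystem] [P.IsCrystallographic] [P.IsReduced]
    (hP : AffineCoxeter.IsEuclidean P)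
    (A : Set E) (hA : AffineCoxeter.IsAlcove P A)
    (i₀ i₁ i₂ : ι) (k₀ k₁ k₂ : ℤ)
    (H₀ H₁ H₂ : AffineSubspace ℝ E)
    (hH₀ : H₀ = AffineCoxeter.hyperplane (P.root i₀) k₀)
    (hH₁ : H₁ = AffineCoxeter.hyperplane (P.root i₁) k₁)
    (hH₂ : H₂ = AffineCoxeter.hyperplane (P.root i₂) k₂)
    (r₀ r₁ r₂ : E ≃ᵃⁱ[ℝ] E)
    (hr₀ : r₀ = AffineCoxeter.affineReflection (P.root i₀) k₀)
    (hr₁ : r₁ = AffineCoxeter.affineReflection (P.root i₁) k₁)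
    (hr₂ : r₂ = AffineCoxeter.affineReflection (P.root i₂) k₂)
    (h₀₁ : AffineCoxeter.AdjacentParallel P H₀ H₁)
    (h₁₂ : AffineCoxeter.AdjacentParallel P H₁ H₂)
    (h₀₂ : H₀ ≠ H₂)
    (x : E ≃ᵃⁱ[ℝ] E) (hx : x ∈ AffineCoxeter.affineWeylGroup P)
    (hxb : AffineCoxeter.BoundedBy (x '' A) H₀ H₁)
    (hlen₂ : AffineCoxeter.length P A (r₂ * r₁ * x) = AffineCoxeter.length P A (r₁ * x) + 1)
    (hlen₁ : AffineCoxeter.length P A (r₁ * x) + 1 = AffineCoxeter.length P A x + 2) :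
    AffineCoxeter.length P A (r₀ * x) = AffineCoxeter.length P A x + 1 ∨
      AffineCoxeter.length P A (r₀ * x) + 1 = AffineCoxeter.length P A x := by
  have : FiniteDimensional ℝ E := FiniteDimensional.of_finrank_pos (by omega)
  -- Completeness serves the Baire argument in `exists_generic_point`.
  have : CompleteSpace E := FiniteDimensional.complete ℝ E
  subst hH₀ hH₁ hH₂ hr₀ hr₁ hr₂
  obtain ⟨i, k, s₀, s₁, s₂⟩ := AffineCoxeter.exists_consecutive_levels h₀₁ h₁₂ h₀₂
  rw [s₀.affineReflection_eq]
  rw [s₁.affineReflection_eq, s₂.affineReflection_eq] at hlen₂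
  rw [s₁.affineReflection_eq] at hlen₁
  rw [s₀.hyperplane_eq, s₁.hyperplane_eq] at hxb
  obtain ⟨a, ha⟩ := hA.nonempty
  obtain ⟨h1, h2⟩ := hxb.inner_mem_Ioo (Set.mem_image_of_mem x ha)
  refine AffineCoxeter.length_reflection_of_translation hP hA ha hx
    (Int.floor_eq_iff.2 ⟨h1.le, h2⟩) (by omega) (by omega)
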